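/- Let $n \ge 1$, let $t_1,\ldots,t_n$ be distinct real numbers and let $\lambda > 0$. Let $B = \big[e^{-\lambda (t_j-t_i)^2/2}\big]_{i,j=1,\ldots,n}$ be the univariate Gaussian matrix, and put $$ V(\mathbf{t}) = \prod_{1\le i<j\le n}(t_j-t_i), \qquad c_n = \prod_{i=1}^{n-1} i!, \qquad N = \binom{n}{2}, \qquad \overline{t} = \frac1n\sum_{i=1}^n t_i, \qquad S = \sum_{i=1}^n (t_i-\overline{t})^2. $$ Then $$ \frac{\lambda^N}{c_n}\, V(\mathbf{t})^2 e^{-\lambda S} \;\le\; \det(B) \;\le\; \frac{\lambda^N}{c_n}\, V(\mathbf{t})^2 . $$ -/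

import Mathlib

noncomputable section

/-- The Vandermonde polynomial `V(t) = ∏_{i < j} (t_j - t_i)`. -/
def vandermondePoly {n : ℕ} (t : Fin n → ℝ) : ℝ :=
  ∏ i : Fin n, ∏ j ∈ Finset.Ioi i, (t j - t i)

/-- The constant `c_n = ∏_{i=1}^{n-1} i!`. -/
def cConst (n : ℕ) : ℝ :=
  ∏ i ∈ Finset.Icc 1 (n - 1), (Nat.factorial i : ℝ)

/-- The univariate Gaussian matrix `B = [exp (-λ (t_j - t_i)² / 2)]`. -/
def gaussianMatrix {n : ℕ} (lam : ℝ) (t : Fin n → ℝ) : Matrix (Fin n) (Fin n) ℝ :=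
  Matrix.of fun i j => Real.exp (-lam * (t j - t i) ^ 2 / 2)

/-- The mean of `t_1, …, t_n`. -/
def nodeMean {n : ℕ} (t : Fin n → ℝ) : ℝ :=
  (1 / (n : ℝ)) * ∑ i : Fin n, t i

/-- The sum of squared deviations from the mean, `S = ∑ (t_i - mean)²`. -/
def sumSqDev {n : ℕ} (t : Fin n → ℝ) : ℝ :=
  ∑ i : Fin n, (t i - nodeMean t) ^ 2

end

/-!
Up to a diagonal scaling, `det B` is `det [exp (x i * y j)]` with `x = t` and `y = λ t`, and `t` may
be sorted. For monotone `x` and `y`, factor `exp (x i * y 0)` out of the rows, so that the first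
column becomes `1`; differences of consecutive rows are then integrals over
`[x i, x (i + 1)]`, and `det [exp (x i * y j)]` is an explicit multiple of the integral of
`det [exp (s i * z j)]` over the `s` interlacing with `x`, where `z j = y (j + 1) - y 0`. The
Vandermonde product `V(x) V(y) / c_n` satisfies the same recursion with `V(s)` as integrand, so the
ratio of the two is compared by induction on `n`. It is at most `exp (∑ x i * y i)` because
`s i ≤ x (i + 1)`, and at least `exp ((∑ x i) * (∑ y j) / n)` by Jensen's inequality, since `∑ s i`
has mean `n / (n + 1) * ∑ x i` under the density proportional to `V(s)` on the interlacing `s`.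
-/

open Matrix MeasureTheory Polynomial

section Determinants

variable {R : Type*} [CommRing R] {n : ℕ}

theorem det_eq_det_row_sub_of_col_zero_eq_one (M : Matrix (Fin (n + 1)) (Fin (n + 1)) R)
    (h : ∀ i, M i 0 = 1) :
    M.det = (of fun i j : Fin n => M i.succ j.succ - M i.castSucc j.succ).det := by
  rw [det_eq_of_forall_row_eq_smul_add_pred (A := M)
    (B := of fun i j => Fin.cases (M 0 j) (fun i => M i.succ j - M i.castSucc j) i)
    (fun _ => 1) (fun j => by simp) (fun i j => by simp), det_succ_column_zero,
    Fin.sum_univ_succ, Finset.sum_eq_zero fun i _ => by simp [h]]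
  simp [h, submatrix]

theorem det_vandermonde_succ_eq_prod_sub_mul (y : Fin (n + 1) → R) :
    (vandermonde y).det = (∏ j : Fin n, (y j.succ - y 0)) *
      (vandermonde fun j : Fin n => y j.succ - y 0).det := by
  rw [det_vandermonde_sub (fun j : Fin n => y j.succ), det_vandermonde, det_vandermonde,
    Fin.prod_univ_succ]
  simp [Fin.prod_Ioi_succ]

theorem det_vandermonde_const_mul (a : R) (t : Fin n → R) :
    (vandermonde fun i => a * t i).det = a ^ n.choose 2 * (vandermonde t).det := by
  have h_prod : ∏ j : Fin n, a ^ (j : ℕ) = a ^ n.choose 2 := by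
    rw [Finset.prod_pow_eq_pow_sum, Fin.sum_univ_eq_sum_range (fun i : ℕ => i),
      Finset.sum_range_id, Nat.choose_two_right]
  rw [← h_prod, ← det_mul_row]
  simp only [vandermonde, mul_pow]
  rfl

theorem det_vandermonde_nonneg_of_monotone [LinearOrder R] [IsStrictOrderedRing R]
    {x : Fin n → R} (hx : Monotone x) : 0 ≤ (vandermonde x).det := by
  rw [det_vandermonde]
  exact Finset.prod_nonneg fun i _ => Finset.prod_nonneg fun j hj =>
    sub_nonneg.2 (hx (Finset.mem_Ioi.1 hj).le)

/-- The exponents are `0, …, n - 1, n + 1`. -/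
theorem det_pow_skip_eq_sum_mul_det_vandermonde (x : Fin (n + 1) → R) :
    (of fun i j : Fin (n + 1) => x i ^ ((j : ℕ) + if j = Fin.last n then 1 else 0)).det =
      (∑ i, x i) * (vandermonde x).det := by
  nontriviality R
  -- `P` vanishes at every `x i`, so the last column may be computed from `X ^ (n + 1) - P`,
  -- whose degree is at most `n` and whose coefficient at `X ^ n` is `∑ i, x i`.
  set P : R[X] := ∏ i, (X - C (x i)) with hP
  have hP_natDegree : P.natDegree = n + 1 := by simp [hP]
  have hP_monic : P.Monic := monic_prod_X_sub_C x _
  have hP_coeff : P.coeff n = -∑ i, x i := by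
    simpa using prod_X_sub_C_coeff_card_pred Finset.univ x (by simp)
  let p : Fin (n + 1) → R[X] := fun j => if j = Fin.last n then X ^ (n + 1) - P else X ^ (j : ℕ)
  have hp_natDegree : ∀ j, (p j).natDegree ≤ j := by
    intro j
    by_cases hj : j = Fin.last n
    · have h_lt : (X ^ (n + 1) - P).natDegree < n + 1 :=
        (isMonicOfDegree_X_pow R (n + 1)).natDegree_sub_lt n.succ_ne_zero ⟨hP_natDegree, hP_monic⟩
      simpa [p, hj] using Nat.le_of_lt_succ h_lt
    · simp [p, hj]
  have hp_eval : (of fun i j : Fin (n + 1) =>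
      x i ^ ((j : ℕ) + if j = Fin.last n then 1 else 0)) = of fun i j => (p j).eval (x i) := by
    have hP_eval : ∀ i, P.eval (x i) = 0 := fun i => by
      rw [hP, eval_prod]
      exact Finset.prod_eq_zero (Finset.mem_univ i) (by simp)
    ext i j
    by_cases hj : j = Fin.last n <;> simp [p, hj, hP_eval]
  have h_diag : ∏ j, (p j).coeff j = ∑ i, x i := by
    simp [Fin.prod_univ_castSucc, p, hP_coeff, coeff_X_pow, Fin.castSucc_ne_last]
  rw [hp_eval, eval_matrixOfPolynomials_eq_vandermonde_mul_matrixOfPolynomials x p hp_natDegree,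
    det_mul, mul_comm, det_of_isUpperTriangular]
  · exact congrArg (· * _) h_diag
  · exact fun i j hij => coeff_eq_zero_of_natDegree_lt ((hp_natDegree j).trans_lt hij)

end Determinants

section IntegralOfDeterminants

theorem integral_det_pi {ι α 𝕜 : Type*} [Fintype ι] [DecidableEq ι] [RCLike 𝕜]
    [MeasurableSpace α] (μ : ι → Measure α) [∀ i, SigmaFinite (μ i)] (f : ι → ι → α → 𝕜)
    (hf : ∀ i j, Integrable (f i j) (μ i)) :
    ∫ s, (of fun i j => f i j (s i)).det ∂(Measure.pi μ) =
      (of fun i j => ∫ a, f i j a ∂(μ i)).det := by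
  simp_rw [← det_transpose (of _), det_apply', transpose_apply, of_apply]
  rw [integral_finsetSum _ fun σ _ => (Integrable.fintype_prod (f := fun i => f i (σ i))
    fun i => hf i (σ i)).const_mul _]
  refine Finset.sum_congr rfl fun σ _ => ?_
  rw [integral_const_mul, integral_fintype_prod_eq_prod (f := fun i => f i (σ i))]

variable {n : ℕ} {x : Fin (n + 1) → ℝ}

theorem det_eq_setIntegral_det_of_hasDerivAt {𝕜 : Type*} [RCLike 𝕜] (hx : Monotone x)
    {F : Fin (n + 1) → ℝ → 𝕜} {f : Fin n → ℝ → 𝕜} (hF_zero : ∀ s, F 0 s = 1)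
    (hF : ∀ j s, HasDerivAt (F j.succ) (f j s) s) (hf : ∀ j, Continuous (f j)) :
    (of fun i j => F j (x i)).det =
      ∫ s in Set.Icc (Fin.init x) (Fin.tail x), (of fun i j => f j (s i)).det := by
  rw [← Set.pi_univ_Icc, volume_pi, Measure.restrict_pi_pi,
    integral_det_pi _ (fun _ => f) fun i j => (hf j).integrableOn_Icc,
    det_eq_det_row_sub_of_col_zero_eq_one _ fun i => hF_zero (x i)]
  congr 1
  ext i j
  simp only [of_apply, Fin.init, Fin.tail]
  rw [integral_Icc_eq_integral_Ioc,
    ← intervalIntegral.integral_of_le (hx Fin.castSucc_lt_succ.le),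
    intervalIntegral.integral_eq_sub_of_hasDerivAt (fun s _ => hF j s)
      ((hf j).intervalIntegrable _ _)]

theorem monotone_of_mem_Icc_init_tail {α : Type*} [Preorder α] {x : Fin (n + 1) → α}
    (hx : Monotone x) {s : Fin n → α} (hs : s ∈ Set.Icc (Fin.init x) (Fin.tail x)) :
    Monotone s := by
  intro i j hij
  rcases hij.eq_or_lt with rfl | hlt
  · exact le_rfl
  · exact (hs.2 i).trans ((hx (Fin.succ_le_castSucc_iff.2 hlt)).trans (hs.1 j))

theorem det_pow_cons_zero_eq_setIntegral (hx : Monotone x) (e : Fin n → ℕ) :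
    (of fun i j => x i ^ (Fin.cons 0 (fun k => e k + 1) : Fin (n + 1) → ℕ) j).det =
      (∏ j, ((e j : ℝ) + 1)) *
        ∫ s in Set.Icc (Fin.init x) (Fin.tail x), (of fun i j => s i ^ e j).det := by
  rw [det_eq_setIntegral_det_of_hasDerivAt hx
    (F := fun j s => s ^ (Fin.cons 0 (fun k => e k + 1) : Fin (n + 1) → ℕ) j)
    (f := fun j s => ((e j : ℝ) + 1) * s ^ e j)
    (fun s => by simp) (fun j s => by simpa using hasDerivAt_pow (e j + 1) s)
    (fun j => by fun_prop), ← integral_const_mul]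
  simp_rw [← det_mul_row, of_apply]

theorem prod_val_add_one_eq_factorial (R : Type*) [CommSemiring R] (n : ℕ) :
    ∏ j : Fin n, (((j : ℕ) : R) + 1) = n.factorial := by
  rw [Fin.prod_univ_eq_prod_range (fun j : ℕ => (j : R) + 1),
    ← Finset.prod_range_add_one_eq_factorial]
  push_cast
  rfl

theorem det_vandermonde_eq_factorial_mul_setIntegral (hx : Monotone x) :
    (vandermonde x).det =
      n.factorial * ∫ s in Set.Icc (Fin.init x) (Fin.tail x), (vandermonde s).det := by
  rw [← prod_val_add_one_eq_factorial]
  refine Eq.trans ?_ (det_pow_cons_zero_eq_setIntegral hx fun j => (j : ℕ))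
  congr 1
  ext i j
  cases j using Fin.cases <;> simp [vandermonde_apply]

theorem setIntegral_sum_mul_det_vandermonde (hx : Monotone x) :
    ∫ s in Set.Icc (Fin.init x) (Fin.tail x), (∑ i, s i) * (vandermonde s).det =
      n / (n + 1) * (∑ i, x i) *
        ∫ s in Set.Icc (Fin.init x) (Fin.tail x), (vandermonde s).det := by
  cases n with
  | zero => simp
  | succ m =>
    have h_skip : (∑ i, x i) * (vandermonde x).det = (m.factorial * (m + 2)) *
        ∫ s in Set.Icc (Fin.init x) (Fin.tail x), (∑ i, s i) * (vandermonde s).det := by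
      have h_prod : ∏ j : Fin (m + 1),
          ((((j : ℕ) + if j = Fin.last m then 1 else 0 : ℕ) : ℝ) + 1) = m.factorial * (m + 2) := by
        rw [Fin.prod_univ_castSucc, ← prod_val_add_one_eq_factorial]
        simp only [Fin.castSucc_ne_last, ↓reduceIte, add_zero, Fin.val_castSucc, Fin.val_last]
        push_cast
        ring
      simp_rw [← det_pow_skip_eq_sum_mul_det_vandermonde, ← h_prod]
      refine Eq.trans ?_ (det_pow_cons_zero_eq_setIntegral hx _)
      congr 1
      ext i j
      cases j using Fin.cases <;> simp [← Fin.succ_last, (Fin.succ_ne_zero _).symm, add_right_comm]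
    rw [det_vandermonde_eq_factorial_mul_setIntegral hx, Nat.factorial_succ] at h_skip
    have : (m.factorial : ℝ) ≠ 0 := by positivity
    push_cast at h_skip ⊢
    field_simp
    apply mul_left_cancel₀ this
    linear_combination -h_skip

end IntegralOfDeterminants

section ExponentialKernel

theorem cConst_succ (n : ℕ) : cConst (n + 1) = n.factorial * cConst n := by
  cases n with
  | zero => simp [cConst]
  | succ n =>
    rw [cConst, cConst, Nat.add_sub_cancel, Nat.add_sub_cancel,
      Finset.prod_Icc_succ_top (Nat.le_add_left 1 n), mul_comm]

theorem cConst_pos (n : ℕ) : 0 < cConst n :=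
  Finset.prod_pos fun i _ => by positivity

variable {n : ℕ} {x : Fin (n + 1) → ℝ}

theorem det_vandermonde_mul_div_cConst_succ (hx : Monotone x) (y : Fin (n + 1) → ℝ) :
    (vandermonde x).det * (vandermonde y).det / cConst (n + 1) =
      (∏ j : Fin n, (y j.succ - y 0)) *
        ((vandermonde fun j : Fin n => y j.succ - y 0).det / cConst n *
          ∫ s in Set.Icc (Fin.init x) (Fin.tail x), (vandermonde s).det) := by
  rw [det_vandermonde_eq_factorial_mul_setIntegral hx, det_vandermonde_succ_eq_prod_sub_mul y,
    cConst_succ]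
  have := (cConst_pos n).ne'
  have : (n.factorial : ℝ) ≠ 0 := by positivity
  field_simp

theorem det_exp_mul_succ_eq_setIntegral (hx : Monotone x) (y : Fin (n + 1) → ℝ) :
    (of fun i j => Real.exp (x i * y j)).det =
      Real.exp ((∑ i, x i) * y 0) * (∏ j : Fin n, (y j.succ - y 0)) *
        ∫ s in Set.Icc (Fin.init x) (Fin.tail x),
          (of fun i j => Real.exp (s i * (y j.succ - y 0))).det := by
  have h_factor : (of fun i j => Real.exp (x i * y j)).det =
      Real.exp ((∑ i, x i) * y 0) * (of fun i j => Real.exp (x i * (y j - y 0))).det := by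
    rw [Finset.sum_mul, Real.exp_sum, ← det_mul_column]
    simp_rw [of_apply, ← Real.exp_add]
    ring_nf
  rw [h_factor, mul_assoc, ← integral_const_mul]
  simp_rw [← det_mul_row, of_apply]
  rw [det_eq_setIntegral_det_of_hasDerivAt hx (F := fun j s => Real.exp (s * (y j - y 0)))
    (f := fun j s => (y j.succ - y 0) * Real.exp (s * (y j.succ - y 0))) (fun s => by simp)
    (fun j s => ?_) (fun j => by fun_prop)]
  simpa [mul_comm] using ((hasDerivAt_id s).mul_const (y j.succ - y 0)).exp

theorem continuous_det_vandermonde (n : ℕ) :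
    Continuous fun s : Fin n → ℝ => (vandermonde s).det := by
  simp_rw [det_vandermonde]
  fun_prop

/-- Jensen's inequality for `exp`: the mean of `∑ i, s i` with respect to the density
`(vandermonde s).det` is `n / (n + 1) * ∑ i, x i`. -/
theorem exp_mul_setIntegral_det_vandermonde_le (hx : Monotone x) (θ : ℝ) :
    Real.exp (θ * (n / (n + 1) * ∑ i, x i)) *
        ∫ s in Set.Icc (Fin.init x) (Fin.tail x), (vandermonde s).det ≤
      ∫ s in Set.Icc (Fin.init x) (Fin.tail x),
        (vandermonde s).det * Real.exp (θ * ∑ i, s i) := by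
  set m : ℝ := n / (n + 1) * ∑ i, x i
  set B := Set.Icc (Fin.init x) (Fin.tail x)
  have h_tangent : ∀ u : ℝ,
      Real.exp (θ * m) * (1 + θ * (u - m)) ≤ Real.exp (θ * u) := fun u => by
    have h := Real.add_one_le_exp (θ * (u - m))
    calc Real.exp (θ * m) * (1 + θ * (u - m)) ≤ Real.exp (θ * m) * Real.exp (θ * (u - m)) := by
          gcongr
          linarith
      _ = Real.exp (θ * u) := by rw [← Real.exp_add]; ring_nf
  have h_cont := continuous_det_vandermonde n
  have h_mean : ∫ s in B, (∑ i, s i - m) * (vandermonde s).det = 0 := by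
    simp_rw [sub_mul]
    rw [integral_sub (Continuous.integrableOn_Icc (by fun_prop))
      (Continuous.integrableOn_Icc (by fun_prop)), setIntegral_sum_mul_det_vandermonde hx,
      integral_const_mul, sub_self]
  calc Real.exp (θ * m) * ∫ s in B, (vandermonde s).det
      = ∫ s in B, Real.exp (θ * m) *
          ((vandermonde s).det + θ * ((∑ i, s i - m) * (vandermonde s).det)) := by
        rw [integral_const_mul, integral_add (Continuous.integrableOn_Icc (by fun_prop))
          (Continuous.integrableOn_Icc (by fun_prop)), integral_const_mul, h_mean, mul_zero,
          add_zero]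
    _ = ∫ s in B, (vandermonde s).det * (Real.exp (θ * m) * (1 + θ * (∑ i, s i - m))) := by
        congr with s
        ring
    _ ≤ ∫ s in B, (vandermonde s).det * Real.exp (θ * ∑ i, s i) :=
        setIntegral_mono_on (Continuous.integrableOn_Icc (by fun_prop))
          (Continuous.integrableOn_Icc (by fun_prop)) measurableSet_Icc fun s hs =>
            mul_le_mul_of_nonneg_left (h_tangent _)
              (det_vandermonde_nonneg_of_monotone (monotone_of_mem_Icc_init_tail hx hs))

theorem monotone_sub_head {G : Type*} [AddCommGroup G] [PartialOrder G] [IsOrderedAddMonoid G]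
    {y : Fin (n + 1) → G} (hy : Monotone y) :
    Monotone fun j : Fin n => y j.succ - y 0 :=
  fun _ _ hij => sub_le_sub_right (hy (Fin.succ_le_succ_iff.2 hij)) _

theorem sub_head_nonneg {G : Type*} [AddCommGroup G] [PartialOrder G] [IsOrderedAddMonoid G]
    {y : Fin (n + 1) → G} (hy : Monotone y) (j : Fin n) : 0 ≤ y j.succ - y 0 :=
  sub_nonneg.2 (hy (Fin.zero_le _))

theorem sum_mul_eq_sum_mul_head_add {R : Type*} [CommRing R] (x y : Fin (n + 1) → R) :
    ∑ i, x i * y i = (∑ i, x i) * y 0 + ∑ j : Fin n, x j.succ * (y j.succ - y 0) := by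
  simp only [Fin.sum_univ_succ, mul_sub, Finset.sum_sub_distrib, add_mul, Finset.sum_mul]
  ring

theorem sum_mul_sum_div_eq_sum_mul_head_add (x y : Fin (n + 1) → ℝ) :
    (∑ i, x i) * (∑ j, y j) / (n + 1 : ℕ) = (∑ i, x i) * y 0 +
      (∑ j : Fin n, (y j.succ - y 0)) / n * (n / (n + 1) * ∑ i, x i) := by
  have h_sum : ∑ j, y j = (n + 1) * y 0 + ∑ j : Fin n, (y j.succ - y 0) := by
    simp only [Fin.sum_univ_succ, Finset.sum_sub_distrib, Finset.sum_const, Finset.card_univ,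
      Fintype.card_fin, nsmul_eq_mul]
    ring
  have h_cancel : (∑ j : Fin n, (y j.succ - y 0)) / n * n = ∑ j : Fin n, (y j.succ - y 0) :=
    div_mul_cancel_of_imp fun h => by
      obtain rfl : n = 0 := by exact_mod_cast h
      simp
  rw [h_sum]
  push_cast
  field_simp
  linear_combination -(∑ i, x i) * h_cancel

end ExponentialKernel

theorem le_det_exp_mul_of_monotone {n : ℕ} {x y : Fin n → ℝ} (hx : Monotone x) (hy : Monotone y) :
    (vandermonde x).det * (vandermonde y).det / cConst n *
        Real.exp ((∑ i, x i) * (∑ j, y j) / n) ≤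
      (of fun i j => Real.exp (x i * y j)).det := by
  induction n with
  | zero => simp [cConst]
  | succ n ih =>
    set z : Fin n → ℝ := fun j => y j.succ - y 0
    set B := Set.Icc (Fin.init x) (Fin.tail x)
    have hz : Monotone z := monotone_sub_head hy
    have h_cont := continuous_det_vandermonde n
    have h_int : (vandermonde z).det / cConst n *
        (Real.exp ((∑ j, z j) / n * (n / (n + 1) * ∑ i, x i)) * ∫ s in B, (vandermonde s).det) ≤
          ∫ s in B, (of fun i j => Real.exp (s i * z j)).det :=
      calc _ ≤ (vandermonde z).det / cConst n *
              ∫ s in B, (vandermonde s).det * Real.exp ((∑ j, z j) / n * ∑ i, s i) :=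
            mul_le_mul_of_nonneg_left (exp_mul_setIntegral_det_vandermonde_le hx _)
              (div_nonneg (det_vandermonde_nonneg_of_monotone hz) (cConst_pos n).le)
        _ ≤ _ := by
            rw [← integral_const_mul]
            refine setIntegral_mono_on (Continuous.integrableOn_Icc (by fun_prop))
              (Continuous.integrableOn_Icc (Continuous.matrix_det (by fun_prop)))
              measurableSet_Icc fun s hs => ?_
            refine Eq.trans_le ?_ (ih (monotone_of_mem_Icc_init_tail hx hs) hz)
            ring_nf
    rw [det_exp_mul_succ_eq_setIntegral hx, det_vandermonde_mul_div_cConst_succ hx,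
      sum_mul_sum_div_eq_sum_mul_head_add, Real.exp_add]
    refine Eq.trans_le ?_ (mul_le_mul_of_nonneg_left h_int
      (mul_nonneg (Real.exp_nonneg _) (Finset.prod_nonneg fun j _ => sub_head_nonneg hy j)))
    ring

theorem det_exp_mul_le_of_monotone {n : ℕ} {x y : Fin n → ℝ} (hx : Monotone x) (hy : Monotone y) :
    (of fun i j => Real.exp (x i * y j)).det ≤
      (vandermonde x).det * (vandermonde y).det / cConst n * Real.exp (∑ i, x i * y i) := by
  induction n with
  | zero => simp [cConst]
  | succ n ih =>
    set z : Fin n → ℝ := fun j => y j.succ - y 0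
    set B := Set.Icc (Fin.init x) (Fin.tail x)
    have hz : Monotone z := monotone_sub_head hy
    have hz_nonneg : ∀ j, 0 ≤ z j := sub_head_nonneg hy
    have hVz := det_vandermonde_nonneg_of_monotone hz
    have h_cont := continuous_det_vandermonde n
    have h_pointwise : ∀ s ∈ B, (of fun i j => Real.exp (s i * z j)).det ≤
        (vandermonde z).det / cConst n * Real.exp (∑ i, x i.succ * z i) *
          (vandermonde s).det := by
      intro s hs
      have hs_mono := monotone_of_mem_Icc_init_tail hx hs
      have hVs := det_vandermonde_nonneg_of_monotone hs_mono
      have hc := cConst_pos n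
      calc _ ≤ (vandermonde s).det * (vandermonde z).det / cConst n *
              Real.exp (∑ i, s i * z i) := ih hs_mono hz
        _ ≤ (vandermonde s).det * (vandermonde z).det / cConst n *
              Real.exp (∑ i, x i.succ * z i) := by
            gcongr with i
            · exact hz_nonneg i
            · exact hs.2 i
        _ = _ := by ring
    have h_int := setIntegral_mono_on (μ := volume)
      (Continuous.integrableOn_Icc (Continuous.matrix_det (by fun_prop)))
      (Continuous.integrableOn_Icc (by fun_prop)) measurableSet_Icc h_pointwise
    rw [integral_const_mul] at h_int
    rw [det_exp_mul_succ_eq_setIntegral hx, det_vandermonde_mul_div_cConst_succ hx,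
      sum_mul_eq_sum_mul_head_add, Real.exp_add]
    refine (mul_le_mul_of_nonneg_left h_int
      (mul_nonneg (Real.exp_nonneg _) (Finset.prod_nonneg fun j _ => hz_nonneg j))).trans_eq ?_
    ring

section GaussianMatrix

variable {n : ℕ}

theorem det_gaussianMatrix_eq_exp_mul_det_exp (t : Fin n → ℝ) (lam : ℝ) :
    (gaussianMatrix lam t).det = Real.exp (-lam * ∑ i, t i ^ 2) *
      (of fun i j => Real.exp (t i * (lam * t j))).det := by
  have h_factor : (gaussianMatrix lam t).det = (∏ i, Real.exp (-lam * t i ^ 2 / 2)) *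
      ((∏ i, Real.exp (-lam * t i ^ 2 / 2)) *
        (of fun i j => Real.exp (t i * (lam * t j))).det) := by
    rw [← det_mul_row, ← det_mul_column]
    congr 1
    ext i j
    simp only [gaussianMatrix, of_apply, ← Real.exp_add]
    ring_nf
  rw [h_factor, ← mul_assoc, ← Real.exp_sum, ← Real.exp_add, Finset.mul_sum,
    ← Finset.sum_add_distrib]
  ring_nf

theorem sumSqDev_eq_sum_sq_sub (t : Fin n → ℝ) :
    sumSqDev t = ∑ i, t i ^ 2 - (∑ i, t i) ^ 2 / n := by
  rcases eq_or_ne n 0 with rfl | hn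
  · simp [sumSqDev]
  · simp only [sumSqDev, nodeMean, sub_sq, Finset.sum_add_distrib, Finset.sum_sub_distrib,
      ← Finset.sum_mul, ← Finset.mul_sum, Finset.sum_const, Finset.card_univ, Fintype.card_fin,
      nsmul_eq_mul]
    field_simp
    ring

theorem vandermondePoly_eq_det (t : Fin n → ℝ) : vandermondePoly t = (vandermonde t).det :=
  (det_vandermonde t).symm

theorem det_gaussianMatrix_comp_perm (t : Fin n → ℝ) (lam : ℝ) (σ : Equiv.Perm (Fin n)) :
    (gaussianMatrix lam (t ∘ σ)).det = (gaussianMatrix lam t).det :=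
  det_submatrix_equiv_self σ (gaussianMatrix lam t)

theorem vandermondePoly_comp_perm_sq (t : Fin n → ℝ) (σ : Equiv.Perm (Fin n)) :
    vandermondePoly (t ∘ σ) ^ 2 = vandermondePoly t ^ 2 := by
  have h_sign : vandermondePoly (t ∘ σ) = Equiv.Perm.sign σ * vandermondePoly t := by
    simp only [vandermondePoly_eq_det]
    exact det_permute σ (vandermonde t)
  rw [h_sign, mul_pow, ← Int.cast_pow, ← Units.val_pow_eq_pow_val, Int.units_sq]
  simp

theorem sumSqDev_comp_perm (t : Fin n → ℝ) (σ : Equiv.Perm (Fin n)) :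
    sumSqDev (t ∘ σ) = sumSqDev t := by
  simp only [sumSqDev_eq_sum_sq_sub, Function.comp_apply, Equiv.sum_comp σ t,
    Equiv.sum_comp σ fun i => t i ^ 2]

variable {t : Fin n → ℝ} {lam : ℝ}

theorem le_det_gaussianMatrix_of_monotone (ht : Monotone t) (hlam : 0 ≤ lam) :
    lam ^ (n.choose 2) / cConst n * vandermondePoly t ^ 2 * Real.exp (-lam * sumSqDev t) ≤
      (gaussianMatrix lam t).det := by
  rw [det_gaussianMatrix_eq_exp_mul_det_exp]
  refine Eq.trans_le ?_ (mul_le_mul_of_nonneg_left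
    (le_det_exp_mul_of_monotone ht (ht.const_mul hlam)) (Real.exp_nonneg _))
  have h_exponent : -lam * sumSqDev t =
      -lam * ∑ i, t i ^ 2 + (∑ i, t i) * (∑ i, lam * t i) / n := by
    rw [sumSqDev_eq_sum_sq_sub, ← Finset.mul_sum]
    ring
  rw [h_exponent, Real.exp_add, det_vandermonde_const_mul, vandermondePoly_eq_det]
  ring

theorem det_gaussianMatrix_le_of_monotone (ht : Monotone t) (hlam : 0 ≤ lam) :
    (gaussianMatrix lam t).det ≤ lam ^ (n.choose 2) / cConst n * vandermondePoly t ^ 2 := by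
  rw [det_gaussianMatrix_eq_exp_mul_det_exp]
  refine (mul_le_mul_of_nonneg_left
    (det_exp_mul_le_of_monotone ht (ht.const_mul hlam)) (Real.exp_nonneg _)).trans_eq ?_
  have h_cancel : Real.exp (-lam * ∑ i, t i ^ 2) * Real.exp (∑ i, t i * (lam * t i)) = 1 := by
    rw [← Real.exp_add, Finset.mul_sum, ← Finset.sum_add_distrib, Real.exp_eq_one_iff]
    exact Finset.sum_eq_zero fun i _ => by ring
  rw [det_vandermonde_const_mul, vandermondePoly_eq_det]
  linear_combination
    (vandermonde t).det * (lam ^ n.choose 2 * (vandermonde t).det) / cConst n * h_cancel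

end GaussianMatrix

theorem corollary1 (n : ℕ) (t : Fin n → ℝ) (ht : Function.Injective t)
    (lam : ℝ) (hlam : 0 < lam) :
    lam ^ (n.choose 2) / cConst n * vandermondePoly t ^ 2 * Real.exp (-lam * sumSqDev t)
        ≤ (gaussianMatrix lam t).det ∧
      (gaussianMatrix lam t).det ≤ lam ^ (n.choose 2) / cConst n * vandermondePoly t ^ 2 := by
  set σ := Tuple.sort t
  have h_mono : Monotone (t ∘ σ) := Tuple.monotone_sort t
  rw [← det_gaussianMatrix_comp_perm t lam σ, ← vandermondePoly_comp_perm_sq t σ,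
    ← sumSqDev_comp_perm t σ]
  exact ⟨le_det_gaussianMatrix_of_monotone h_mono hlam.le,
    det_gaussianMatrix_le_of_monotone h_mono hlam.le⟩
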